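/- For a (not necessarily commutative) ring $S$ with identity, let $J(S)$ be its Jacobson radical and put $J^{\#}(S)=\{s\in S \mid s^n\in J(S) \text{ for some integer } n\ge 1\}$. An element $a\in S$ is called strongly $J^{\#}$-clean if there is an idempotent $e\in S$ with $a-e\in J^{\#}(S)$ and $ea=ae$. A commutative ring $R$ with identity is called projective-free if every finitely generated projective $R$-module is free. **Theorem 3.1.** Let $R$ be a projective-free commutative ring, let $A(x)=(a_{ij}(x))\in M_2(R[[x]])$ be a $2\times 2$ matrix over the power series ring $R[[x]]$, and let $A(0)=(a_{ij}(0))\in M_2(R)$ be the matrix of constant terms. Then $A(x)$ is strongly $J^{\#}$-clean in $M_2(R[[x]])$ if and only if $A(0)$ is strongly $J^{\#}$-clean in $M_2(R)$. -/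

import Mathlib

universe u

/-- A commutative ring `R` is projective-free if every finitely generated projective `R`-module is
free. (Every finitely generated `R`-module is isomorphic to one in the universe of `R`.) -/
def IsProjectiveFree (R : Type u) [CommRing R] : Prop :=
  ∀ (M : Type u) [AddCommGroup M] [Module R M] [Module.Finite R M] [Module.Projective R M],
    Module.Free R M

/-- The set of elements of a (not necessarily commutative) ring having some positive power in the
Jacobson radical. -/
def jSharp (S : Type u) [Ring S] : Set S :=
  {x | ∃ n : ℕ, 0 < n ∧ x ^ n ∈ Ring.jacobson S}

/-- `a` is the sum of an idempotent and an element of `jSharp S` that commute. -/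
def IsStronglyJSharpClean {S : Type u} [Ring S] (a : S) : Prop :=
  ∃ e : S, IsIdempotentElem e ∧ a - e ∈ jSharp S ∧ e * a = a * e

open PowerSeries Matrix

/-! Membership in `jSharp` depends only on constant terms, so the task is to lift an idempotent `e`
commuting with `A(0)` to one commuting with `A`. Projective-freeness leaves `e = 0`, `e = 1`, or
`det e = 0`, `tr e = 1`. In the last case `A(0) = α(1 - e) + (1 + β)e` with `α`, `β` in the radical,
so the eigenvalues differ by a unit. Hensel's lemma lifts `α` to a root `a` of the characteristic
polynomial of `A`, and `(A - a)/(tr A - 2a)` is the required idempotent. -/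

/-- The ideal `(d)` is a direct summand of `R`, hence free, and `d` acts on it as the identity; a
basis vector, if any, forces `d = 1`. -/
theorem IsProjectiveFree.eq_zero_or_one_of_isIdempotentElem {R : Type u} [CommRing R]
    (hR : IsProjectiveFree R) {d : R} (hd : IsIdempotentElem d) : d = 0 ∨ d = 1 := by
  let M : Ideal R := Ideal.span {d}
  have hfix : ∀ m : M, d * (m : R) = m := by
    rintro ⟨m, hm⟩
    obtain ⟨c, rfl⟩ := Ideal.mem_span_singleton'.1 hm
    change d * (c * d) = c * d
    rw [mul_left_comm, hd.eq]
  have hdM : d ∈ M := Ideal.mem_span_singleton_self d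
  have : Module.Projective R M := by
    refine Module.Projective.of_split M.subtype (LinearMap.toSpanSingleton R M ⟨d, hdM⟩) ?_
    ext m
    simpa [mul_comm] using hfix m
  have : Module.Finite R M := Module.Finite.span_singleton R d
  have : Module.Free R M := hR M
  let b := Module.Free.chooseBasis R M
  rcases isEmpty_or_nonempty (Module.Free.ChooseBasisIndex R M) with h | ⟨⟨i⟩⟩
  · left
    have : Subsingleton M := b.repr.toEquiv.subsingleton
    simpa using congrArg Subtype.val (Subsingleton.elim (⟨d, hdM⟩ : M) 0)
  · right
    have h : d • b i = b i := Subtype.ext (hfix (b i))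
    simpa using congrArg (fun m => b.repr m i) h

theorem Matrix.mem_jacobson_iff_forall_mem {R : Type*} [CommRing R] {n : Type*} [Fintype n]
    [DecidableEq n] {M : Matrix n n R} :
    M ∈ Ring.jacobson (Matrix n n R) ↔ ∀ i j, M i j ∈ Ring.jacobson R := by
  have h := congrArg (fun I => M ∈ I) (TwoSidedIdeal.matrix_jacobson_bot (R := R) (n := n))
  simp only [TwoSidedIdeal.mem_matrix, TwoSidedIdeal.mem_jacobson_iff, eq_iff_iff,
    TwoSidedIdeal.mem_bot] at h
  rw [← Ideal.jacobson_bot, ← Ideal.jacobson_bot]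
  simp only [Ideal.mem_jacobson_iff, Ideal.mem_bot]
  exact h.symm

theorem PowerSeries.mem_jacobson_iff_constantCoeff_mem {R : Type*} [CommRing R] {f : R⟦X⟧} :
    f ∈ Ring.jacobson R⟦X⟧ ↔ constantCoeff f ∈ Ring.jacobson R := by
  rw [← Ideal.jacobson_bot, ← Ideal.jacobson_bot, Ideal.mem_jacobson_bot, Ideal.mem_jacobson_bot]
  simp only [PowerSeries.isUnit_iff_constantCoeff, map_add, map_mul, map_one]
  exact ⟨fun h y => by simpa using h (C y), fun h y => h _⟩

theorem Matrix.mem_jSharp_iff_map_constantCoeff {R : Type*} [CommRing R] {n : Type*} [Fintype n]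
    [DecidableEq n] {M : Matrix n n R⟦X⟧} :
    M ∈ jSharp (Matrix n n R⟦X⟧) ↔
      M.map (constantCoeff (R := R)) ∈ jSharp (Matrix n n R) := by
  simp only [jSharp, Set.mem_ofPred_eq, ← Matrix.map_pow, Matrix.mem_jacobson_iff_forall_mem,
    PowerSeries.mem_jacobson_iff_constantCoeff_mem, Matrix.map_apply]

instance PowerSeries.isAdicComplete_span_X {R : Type*} [CommRing R] :
    IsAdicComplete (Ideal.span {(X : R⟦X⟧)}) R⟦X⟧ where
  haus' f hf := by
    ext n
    have := hf (n + 1)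
    rw [SModEq.zero, smul_eq_mul, Ideal.mul_top, Ideal.span_singleton_pow,
      Ideal.mem_span_singleton, X_pow_dvd_iff] at this
    simpa using this n n.lt_succ_self
  prec' f hf := by
    simp only [SModEq.sub_mem, smul_eq_mul, Ideal.mul_top, Ideal.span_singleton_pow,
      Ideal.mem_span_singleton, X_pow_dvd_iff, map_sub, sub_eq_zero] at hf ⊢
    -- Congruence modulo `X ^ (n + 1)` fixes coefficient `n` from index `n + 1` on.
    refine ⟨PowerSeries.mk fun n => coeff n (f (n + 1)), fun n m hm => ?_⟩
    rw [coeff_mk]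
    exact (hf hm m m.lt_succ_self).symm

/-- Hensel's lemma for a monic quadratic polynomial over a power series ring. -/
theorem PowerSeries.exists_quadratic_root {R : Type*} [CommRing R] (t d : R⟦X⟧) (r : R)
    (hr : r ^ 2 - constantCoeff t * r + constantCoeff d = 0)
    (hu : IsUnit (2 * r - constantCoeff t)) :
    ∃ a : R⟦X⟧, a ^ 2 - t * a + d = 0 ∧ constantCoeff a = r := by
  let p : Polynomial R⟦X⟧ := .X ^ 2 - .C t * .X + .C d
  have hp : p.Monic := by
    dsimp only [p]
    monicity!
  obtain ⟨a, ha, har⟩ := HenselianRing.is_henselian (I := Ideal.span {(X : R⟦X⟧)}) p hp (C r)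
    (by
      rw [Ideal.mem_span_singleton, X_dvd_iff]
      simpa [p] using hr)
    (by
      refine IsUnit.map _ (PowerSeries.isUnit_iff_constantCoeff.2 ?_)
      simpa [p, one_add_one_eq_two, map_ofNat] using hu)
  refine ⟨a, by simpa [p, Polynomial.IsRoot] using ha, ?_⟩
  rw [Ideal.mem_span_singleton, X_dvd_iff] at har
  simpa [sub_eq_zero] using har

/-- Modelled on the rank-one identity `(uvᵀ)M(uvᵀ) = (vᵀMu)uvᵀ`. -/
theorem Matrix.mul_mul_eq_trace_smul_of_det_eq_zero {R : Type*} [CommRing R]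
    {e : Matrix (Fin 2) (Fin 2) R} (he : e.det = 0) (M : Matrix (Fin 2) (Fin 2) R) :
    e * M * e = (e * M).trace • e := by
  rw [det_fin_two] at he
  ext i j
  fin_cases i <;> fin_cases j <;>
    simp [Matrix.mul_apply, Fin.sum_univ_two, Matrix.trace]
  · linear_combination (-M 1 1) * he
  · linear_combination M 0 1 * he
  · linear_combination M 1 0 * he
  · linear_combination (-M 0 0) * he

theorem Matrix.mul_eq_trace_smul_of_commute {R : Type*} [CommRing R]
    {e M : Matrix (Fin 2) (Fin 2) R} (hdet : e.det = 0) (he : IsIdempotentElem e)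
    (hc : Commute e M) : e * M = (e * M).trace • e := by
  rw [← mul_mul_eq_trace_smul_of_det_eq_zero hdet M, hc.eq, mul_assoc, he.eq]

/-- On the range of `e`, `w` acts as the scalar `t = tr(ew)`, so `t ^ n = tr(e w ^ n)` lies in the
Jacobson radical, which is a radical ideal. -/
theorem Matrix.trace_mul_mem_jacobson {R : Type*} [CommRing R]
    {e w : Matrix (Fin 2) (Fin 2) R} (hdet : e.det = 0) (htr : e.trace = 1)
    (he : IsIdempotentElem e) (hc : Commute e w) (hw : w ∈ jSharp (Matrix (Fin 2) (Fin 2) R)) :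
    (e * w).trace ∈ Ring.jacobson R := by
  obtain ⟨n, -, hn⟩ := hw
  have hew := mul_eq_trace_smul_of_commute hdet he hc
  generalize (e * w).trace = t at hew ⊢
  have hpow : ∀ k : ℕ, e * w ^ k = t ^ k • e := by
    intro k
    induction k with
    | zero => simp
    | succ k ih => rw [pow_succ', ← mul_assoc, hew, smul_mul_assoc, ih, smul_smul, pow_succ']
  have hmem := Matrix.mem_jacobson_iff_forall_mem.1 (Ideal.mul_mem_left _ e hn)
  have htrace : (e * w ^ n).trace ∈ Ring.jacobson R := by
    rw [trace_fin_two]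
    exact add_mem (hmem 0 0) (hmem 1 1)
  rw [hpow n, trace_smul, htr, smul_eq_mul, mul_one, ← Ideal.jacobson_bot] at htrace
  rw [← Ideal.jacobson_bot]
  exact Ideal.isRadical_jacobson _ ⟨n, htrace⟩

/-- A nontrivial idempotent commuting with the reduction of `A` lifts to an idempotent commuting
with `A`, provided the two eigenvalues of the reduction differ by a unit. -/
theorem PowerSeries.exists_isIdempotentElem_commute_map_eq {R : Type*} [CommRing R]
    {A : Matrix (Fin 2) (Fin 2) R⟦X⟧} {e : Matrix (Fin 2) (Fin 2) R} {r δ : R}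
    (hdet : e.det = 0) (htr : e.trace = 1) (hδ : IsUnit δ)
    (hA : A.map (constantCoeff (R := R)) = r • 1 + δ • e) :
    ∃ E : Matrix (Fin 2) (Fin 2) R⟦X⟧, IsIdempotentElem E ∧ E * A = A * E ∧
      E.map (constantCoeff (R := R)) = e := by
  have hA' : ∀ i j, constantCoeff (A i j) = r * (1 : Matrix (Fin 2) (Fin 2) R) i j + δ * e i j :=
    fun i j => by simpa using congrFun (congrFun hA i) j
  have ht : constantCoeff A.trace = 2 * r + δ := by
    rw [trace_fin_two] at htr ⊢
    simp only [map_add, hA', Matrix.one_apply_eq]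
    linear_combination δ * htr
  have hd : constantCoeff A.det = r ^ 2 + r * δ := by
    rw [trace_fin_two] at htr
    rw [det_fin_two] at hdet ⊢
    simp [hA']
    linear_combination r * δ * htr + δ ^ 2 * hdet
  obtain ⟨a, ha, har⟩ := exists_quadratic_root A.trace A.det r
    (by rw [ht, hd]; ring) (by rw [ht]; simpa using hδ.neg)
  have hu : constantCoeff (A.trace - 2 * a) = δ := by simp [ht, har, map_ofNat]
  obtain ⟨u, hu'⟩ := PowerSeries.isUnit_iff_constantCoeff.2 (hu ▸ hδ)
  -- Cayley–Hamilton: the other root is `tr A - a`, so `(A - a)(A - (tr A - a)) = 0`.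
  have hsq : (A - a • 1) * (A - a • 1) = (u : R⟦X⟧) • (A - a • 1) := by
    rw [hu']
    rw [trace_fin_two, det_fin_two] at ha
    rw [trace_fin_two]
    ext1 i j
    fin_cases i <;> fin_cases j <;> simp [Matrix.mul_apply, Fin.sum_univ_two]
    · linear_combination -ha
    · ring
    · ring
    · linear_combination -ha
  refine ⟨(↑u⁻¹ : R⟦X⟧) • (A - a • 1), ?_, ?_, ?_⟩
  · rw [IsIdempotentElem, smul_mul_smul_comm, hsq, smul_smul, mul_assoc, Units.inv_mul, mul_one]
  · simp [sub_mul, mul_sub]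
  · have hinv : constantCoeff (↑u⁻¹ : R⟦X⟧) * δ = 1 := by
      rw [← hu, ← hu', ← map_mul, Units.inv_mul, map_one]
    ext i j
    have h1 : constantCoeff ((1 : Matrix (Fin 2) (Fin 2) R⟦X⟧) i j) =
        (1 : Matrix (Fin 2) (Fin 2) R) i j := by
      by_cases h : i = j <;> simp [Matrix.one_apply, h]
    simp only [Matrix.map_apply, Matrix.smul_apply, Matrix.sub_apply, smul_eq_mul, map_mul,
      map_sub, hA', har, h1]
    linear_combination e i j * hinv

theorem IsProjectiveFree.eq_zero_or_eq_one_or_det_trace {R : Type u} [CommRing R]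
    (hR : IsProjectiveFree R) {e : Matrix (Fin 2) (Fin 2) R} (he : IsIdempotentElem e) :
    e = 0 ∨ e = 1 ∨ (e.det = 0 ∧ e.trace = 1) := by
  have hdet : IsIdempotentElem e.det := by rw [IsIdempotentElem, ← det_mul, he.eq]
  rcases hR.eq_zero_or_one_of_isIdempotentElem hdet with h0 | h1
  · have hfix : e = e.trace • e := by
      simpa [he.eq] using mul_mul_eq_trace_smul_of_det_eq_zero h0 1
    have htr : IsIdempotentElem e.trace := by
      simpa [IsIdempotentElem] using (congrArg trace hfix).symm
    rcases hR.eq_zero_or_one_of_isIdempotentElem htr with h | h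
    · left
      rw [hfix, h, zero_smul]
    · exact Or.inr (Or.inr ⟨h0, h⟩)
  · right; left
    have hu : IsUnit e := (Matrix.isUnit_iff_isUnit_det e).2 (h1 ▸ isUnit_one)
    exact hu.mul_left_cancel (by rw [he.eq, mul_one])

theorem theorem3p1 (R : Type u) [CommRing R] (hR : IsProjectiveFree R)
    (A : Matrix (Fin 2) (Fin 2) (PowerSeries R)) :
    IsStronglyJSharpClean A ↔
      IsStronglyJSharpClean (A.map (PowerSeries.constantCoeff (R := R))) := by
  have lift : ∀ E : Matrix (Fin 2) (Fin 2) R⟦X⟧, IsIdempotentElem E → E * A = A * E →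
      A.map (constantCoeff (R := R)) - E.map (constantCoeff (R := R)) ∈ jSharp _ →
      IsStronglyJSharpClean A := by
    intro E hE hc hw
    refine ⟨E, hE, Matrix.mem_jSharp_iff_map_constantCoeff.2 ?_, hc⟩
    rwa [Matrix.map_sub _ (map_sub _)]
  constructor
  · rintro ⟨E, hE, hw, hc⟩
    refine ⟨E.map (constantCoeff (R := R)), ?_, ?_, ?_⟩
    · rw [IsIdempotentElem, ← Matrix.map_mul, hE.eq]
    · rw [← Matrix.map_sub _ (map_sub _)]
      exact Matrix.mem_jSharp_iff_map_constantCoeff.1 hw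
    · rw [← Matrix.map_mul, ← Matrix.map_mul, hc]
  · rintro ⟨e, he, hw, hc⟩
    rcases hR.eq_zero_or_eq_one_or_det_trace he with rfl | rfl | ⟨hdet, htr⟩
    · exact lift 0 (by simp [IsIdempotentElem]) (by simp) (by rwa [Matrix.map_zero _ (map_zero _)])
    · exact lift 1 (by simp [IsIdempotentElem]) (by simp) (by rwa [Matrix.map_one _ (map_zero _) (map_one _)])
    have hdet' : (1 - e).det = 0 := by
      rw [det_fin_two] at hdet ⊢
      rw [trace_fin_two] at htr
      simp
      linear_combination hdet - htr
    have htr' : (1 - e).trace = 1 := by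
      rw [trace_sub, htr]
      norm_num [trace_fin_two]
    set w := A.map (constantCoeff (R := R)) - e with hw_def
    have hce : Commute e w := Commute.sub_right hc (Commute.refl e)
    have hce' : Commute (1 - e) w := (Commute.one_left w).sub_left hce
    have hβ := trace_mul_mem_jacobson hdet htr he hce hw
    have hα := trace_mul_mem_jacobson hdet' htr' he.one_sub hce' hw
    have hew := mul_eq_trace_smul_of_commute hdet he hce
    have hew' := mul_eq_trace_smul_of_commute hdet' he.one_sub hce'
    set α := ((1 - e) * w).trace
    set β := (e * w).trace
    have hδ : IsUnit (1 + β - α) := by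
      refine Ideal.isUnit_of_sub_one_mem_jacobson_bot _ ?_
      rw [Ideal.jacobson_bot]
      convert! sub_mem hβ hα using 1
      ring
    -- `A(0) = e + w` with `w = βe + α(1 - e)`, that is, `A(0) = α + (1 + β - α)e`.
    obtain ⟨E, hE, hEA, hEe⟩ := exists_isIdempotentElem_commute_map_eq (A := A) (r := α)
      hdet htr hδ (by
        have : w = β • e + α • (1 - e) := by rw [← hew, ← hew']; noncomm_ring
        rw [← sub_add_cancel (A.map _) e, ← hw_def, this]
        module)
    exact lift E hE hEA (by rwa [hEe])
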